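/- For a nonnegative integer $n$, let $Q_2(n)$ denote the number of partitions of $n$ into distinct parts, none of which is $\equiv 2 \pmod 4$. A Göllnitz-Gordon partition is a partition whose parts differ by at least $2$, where the inequality is strict if a part is even (that is, two parts of which at least one is even differ by more than $2$). For a partition $\pi$ and a part $b$ of $\pi$, let $t(b)=t(b;\pi)$ be the number of odd parts of $\pi$ that are smaller than $b$. Let $\mathcal S$ be the set of all special Göllnitz-Gordon partitions, namely the Göllnitz-Gordon partitions $\pi$ such that every even part $b$ of $\pi$ satisfies $$b\equiv 2t(b)\pmod 4.$$ A chain $\chi$ of a partition $\pi$ into parts differing by at least $2$ is a maximal string of parts of $\pi$ with consecutive differences exactly $2$; all parts of a chain have the same parity, and $\chi$ is called odd if they are odd. Let $\lambda(\chi)$ be the least part of $\chi$. For $\pi\in\mathcal S$ and a chain $\chi$ of $\pi$, put $\omega(\chi)=2$ if $\chi$ is an odd chain, $\lambda(\chi)\ge 5$ and $\lambda(\chi)\equiv 1+2t(\lambda(\chi))\pmod 4$, and $\omega(\chi)=1$ otherwise. Let $\omega(\pi)=\prod_{\chi}\omega(\chi)$, the product over all chains $\chi$ of $\pi$. Then for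 every integer $n\ge 0$, $$Q_2(n)=\sum_{\pi\in\mathcal S,\ \sigma(\pi)=n}\omega(\pi),$$ where $\sigma(\pi)$ is the sum of the parts of $\pi$. -/

import Mathlib

namespace GollnitzGordon

/-- `Q i n` is the number of partitions of `n` into distinct parts, none of which is congruent
to `i` modulo `4`. -/
def Q (i n : ℕ) : ℕ :=
  ((Nat.Partition.distincts n).filter (fun π => ∀ a ∈ π.parts, ¬ a ≡ i [MOD 4])).card

/-- A Göllnitz-Gordon partition: the parts differ by at least `2`, and any two parts of which at
least one is even differ by more than `2`. -/
def IsGollnitzGordon {n : ℕ} (π : n.Partition) : Prop :=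
  π.parts.Nodup ∧
    ∀ a ∈ π.parts, ∀ b ∈ π.parts, a < b → a + 2 ≤ b ∧ (Even a ∨ Even b → a + 2 < b)

/-- `t π b` is the number of odd parts of `π` that are smaller than `b`. -/
def t {n : ℕ} (π : n.Partition) (b : ℕ) : ℕ :=
  (π.parts.filter (fun a => Odd a ∧ a < b)).card

/-- A special Göllnitz-Gordon partition: every even part `b` satisfies `b ≡ 2 t(b) (mod 4)`. -/
def IsSpecial {n : ℕ} (π : n.Partition) : Prop :=
  IsGollnitzGordon π ∧ ∀ b ∈ π.parts, Even b → b ≡ 2 * t π b [MOD 4]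

/-- A nonempty string of integers with consecutive differences exactly `2`, that is, a set
`{a, a + 2, …, a + 2 (k - 1)}` where `k ≥ 1` is its number of elements. -/
def IsString (c : Finset ℕ) : Prop :=
  ∃ a ∈ c, c = (Finset.range c.card).image (fun i => a + 2 * i)

instance : DecidablePred IsString := fun c => by unfold IsString; infer_instance

/-- The strings formed by parts of `π`. -/
def strings {n : ℕ} (π : n.Partition) : Finset (Finset ℕ) :=
  π.parts.toFinset.powerset.filter IsString

/-- The chains of `π`: the strings of parts that are maximal under inclusion. -/
def chains {n : ℕ} (π : n.Partition) : Finset (Finset ℕ) :=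
  (strings π).filter (fun c => ∀ d ∈ strings π, c ⊆ d → d = c)

/-- The weight of a chain `c` of `π`: it is `2` if all parts of `c` are odd and the least part `l`
of `c` satisfies `l ≥ 5` and `l ≡ 1 + 2 t(l) (mod 4)`, and `1` otherwise. -/
def chainWeight {n : ℕ} (π : n.Partition) (c : Finset ℕ) : ℕ :=
  if (∀ x ∈ c, Odd x) ∧ ∃ l ∈ c, (∀ x ∈ c, l ≤ x) ∧ 5 ≤ l ∧ l ≡ 1 + 2 * t π l [MOD 4]
  then 2 else 1

/-- The weight of a partition: the product of the weights of its chains. -/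
def weight {n : ℕ} (π : n.Partition) : ℕ := ∏ c ∈ chains π, chainWeight π c

instance {n : ℕ} : DecidablePred (IsGollnitzGordon (n := n)) := fun π => by
  unfold IsGollnitzGordon; infer_instance

instance {n : ℕ} : DecidablePred (IsSpecial (n := n)) := fun π => by
  unfold IsSpecial; infer_instance

/-- The set of special Göllnitz-Gordon partitions of `n`. -/
def special (n : ℕ) : Finset n.Partition := Finset.univ.filter IsSpecial

end GollnitzGordon

/-!
The sets of parts are refined by the number `r` of odd parts. For an odd part `l` or an even part
`b` put `l' = l - 2 t(l)` and `b' = b - 2 t(b)`. Then the parts of a special Göllnitz-Gordon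
partition become `r` odd numbers `l'`, repetitions allowed, and distinct positive multiples `b'`
of `4` with `b' + 1 ≠ l'` for all `l'`; a chain of odd parts becomes a block of equal values `l'`,
and its weight is `2` exactly if `l' ≡ 1 [MOD 4]` and `l' ≥ 5`. So the weight `2` offers the same
number of choices at the value `4 * j + 1` as an even part with `b' = 4 * j` does when the value
`4 * j + 1` is free. This suggests, and the recurrences below prove, that for a bounded range of
values the even parts and the weights together contribute a product of factors `1 + q ^ (4 * j)`:

* the weighted generating function of the special partitions with `r` odd parts and all parts at
  most `2 * L` is `e_r(q, q ^ 3, …, q ^ (2 * L - 1)) * ∏ j ≤ (L - r) / 2, (1 + q ^ (4 * j))`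
  (`genFun_specialSets`).

No values `l'`, `b'` are needed for the proof. Removing the largest part gives recurrences in `L`
for these generating functions and for those of the partitions whose largest part is `2 * L + 1`
(`genFun_top_even`, `genFun_top_odd_succ`); whether a part `2 * L + 1` starts a chain of weight `2`,
and whether a part `2 * L + 2` is admissible, depends only on the parity of `L - r`. The closed
forms satisfy the recurrences by the two `q`-Pascal rules (`oddGen_succ_succ`,
`oddGen_succ_succ'`).

Summing over `r` and letting `L` grow, the product becomes
`∏ i, (1 + q ^ (2 * i + 1)) * ∏ j, (1 + q ^ (4 * j))`, the generating function of `Q 2`. In place of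
a limit, the coefficient of `q ^ n` is compared for `L = 2 * n` (`X_pow_dvd_oddGen_mul_sub`).
-/

namespace GollnitzGordon

open Finset Polynomial

/-! ### Distinct partitions as finite sets -/

/-- The number of odd elements of `S`. -/
def oddCount (S : Finset ℕ) : ℕ := #{a ∈ S | Odd a}

/-- The number of odd elements of `S` below `b`; this is `t` for finite sets. -/
def oddBelow (S : Finset ℕ) (b : ℕ) : ℕ := #{a ∈ S | Odd a ∧ a < b}

/-- The conditions of a special Göllnitz-Gordon partition, for a finite set of parts. -/
def IsSpecialSet (S : Finset ℕ) : Prop :=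
  (∀ a ∈ S, ∀ b ∈ S, a < b → a + 2 ≤ b ∧ (Even a ∨ Even b → a + 2 < b)) ∧
    ∀ b ∈ S, Even b → b ≡ 2 * oddBelow S b [MOD 4]

instance : DecidablePred IsSpecialSet := fun S => by unfold IsSpecialSet; infer_instance

/-- The contribution of a part `l` to the weight: the weight of the chain that starts at `l`, and
`1` if no chain starts at `l`. The subtraction does not truncate, as `5 ≤ l` is required. -/
def partWeight (S : Finset ℕ) (l : ℕ) : ℕ :=
  if Odd l ∧ l - 2 ∉ S ∧ 5 ≤ l ∧ l ≡ 1 + 2 * oddBelow S l [MOD 4] then 2 else 1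

/-- The weight of a finite set of parts, as a product over the parts rather than the chains. -/
def setWeight (S : Finset ℕ) : ℕ := ∏ l ∈ S, partWeight S l

theorem oddBelow_insert_of_le {S : Finset ℕ} {M b : ℕ} (h : b ≤ M) :
    oddBelow (insert M S) b = oddBelow S b := by
  unfold oddBelow
  rw [filter_insert, if_neg (by omega)]

theorem oddBelow_eq_oddCount {S : Finset ℕ} {M : ℕ} (h : ∀ a ∈ S, a < M) :
    oddBelow S M = oddCount S := by
  unfold oddBelow oddCount
  congr 1
  exact filter_congr fun a ha => by simp [h a ha]

theorem oddCount_insert {S : Finset ℕ} {M : ℕ} (h : M ∉ S) :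
    oddCount (insert M S) = oddCount S + if Odd M then 1 else 0 := by
  unfold oddCount
  rw [filter_insert]
  split_ifs
  · rw [card_insert_of_notMem (by simp [h])]
  · rfl

theorem isSpecialSet_insert {S : Finset ℕ} {M : ℕ} (h : ∀ a ∈ S, a < M) :
    IsSpecialSet (insert M S) ↔ IsSpecialSet S ∧
      (∀ a ∈ S, a + 2 ≤ M ∧ (Even a ∨ Even M → a + 2 < M)) ∧
      (Even M → M ≡ 2 * oddCount S [MOD 4]) := by
  have hb : ∀ b ∈ S, oddBelow (insert M S) b = oddBelow S b := fun b hb =>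
    oddBelow_insert_of_le (h b hb).le
  constructor
  · rintro ⟨h1, h2⟩
    refine ⟨⟨fun a ha b hb => h1 a (mem_insert_of_mem ha) b (mem_insert_of_mem hb), ?_⟩, ?_, ?_⟩
    · intro b hbS hev
      rw [← hb b hbS]
      exact h2 b (mem_insert_of_mem hbS) hev
    · exact fun a ha => h1 a (mem_insert_of_mem ha) M (mem_insert_self ..) (h a ha)
    · intro hev
      have := h2 M (mem_insert_self ..) hev
      rwa [oddBelow_insert_of_le le_rfl, oddBelow_eq_oddCount h] at this
  · rintro ⟨⟨h1, h2⟩, h3, h4⟩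
    refine ⟨?_, ?_⟩
    · intro a ha b hbS hab
      rw [mem_insert] at ha hbS
      rcases ha with rfl | ha
      · rcases hbS with rfl | hbS
        · omega
        · exact absurd (h b hbS) (by omega)
      · rcases hbS with rfl | hbS
        · exact h3 a ha
        · exact h1 a ha b hbS hab
    · intro b hbS hev
      rw [mem_insert] at hbS
      rcases hbS with rfl | hbS
      · rw [oddBelow_insert_of_le le_rfl, oddBelow_eq_oddCount h]
        exact h4 hev
      · rw [hb b hbS]
        exact h2 b hbS hev

theorem setWeight_insert {S : Finset ℕ} {M : ℕ} (h : ∀ a ∈ S, a < M) :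
    setWeight (insert M S) = setWeight S *
      if Odd M ∧ M - 2 ∉ S ∧ 5 ≤ M ∧ M ≡ 1 + 2 * oddCount S [MOD 4] then 2 else 1 := by
  have hM : M ∉ S := fun hm => (h M hm).false
  unfold setWeight
  rw [prod_insert hM, mul_comm]
  congr 1
  · refine prod_congr rfl fun l hl => ?_
    have := h l hl
    unfold partWeight
    have hne : l - 2 ≠ M := by omega
    simp only [oddBelow_insert_of_le this.le, mem_insert, hne, false_or]
  · unfold partWeight
    rw [oddBelow_insert_of_le le_rfl, oddBelow_eq_oddCount h]
    refine if_congr ⟨fun ⟨h1, h2, h3, h4⟩ => ⟨h1, fun h => h2 (mem_insert_of_mem h), h3, h4⟩,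
      fun ⟨h1, h2, h3, h4⟩ => ⟨h1, fun hm => ?_, h3, h4⟩⟩ rfl rfl
    exact h2 (mem_of_mem_insert_of_ne hm (by omega))

/-! ### Generating functions by the number of odd parts -/

/-- The special sets of parts in `[1, N]` that have `r` odd elements. -/
def specialSets (N r : ℕ) : Finset (Finset ℕ) :=
  {S ∈ (Icc 1 N).powerset | IsSpecialSet S ∧ oddCount S = r}

/-- The weighted generating function, by the sum of the parts, of a family of sets of parts. -/
noncomputable def genFun (F : Finset (Finset ℕ)) : ℤ[X] :=
  ∑ S ∈ F, (setWeight S : ℤ[X]) * X ^ (∑ i ∈ S, i)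

theorem mem_specialSets {N r : ℕ} {S : Finset ℕ} :
    S ∈ specialSets N r ↔ (∀ a ∈ S, 1 ≤ a ∧ a ≤ N) ∧ IsSpecialSet S ∧ oddCount S = r := by
  simp [specialSets, subset_iff]

theorem genFun_eq_filter_add_filter_not (F : Finset (Finset ℕ)) (p : Finset ℕ → Prop)
    [DecidablePred p] : genFun F = genFun {S ∈ F | p S} + genFun {S ∈ F | ¬ p S} :=
  (sum_filter_add_sum_filter_not F p _).symm

theorem genFun_specialSets_succ (N r : ℕ) :
    genFun (specialSets (N + 1) r) =
      genFun (specialSets N r) + genFun {S ∈ specialSets (N + 1) r | N + 1 ∈ S} := by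
  rw [genFun_eq_filter_add_filter_not _ (N + 1 ∈ ·), add_comm]
  congr 2
  ext S
  simp only [mem_filter, mem_specialSets]
  constructor
  · rintro ⟨⟨h1, h2⟩, h3⟩
    refine ⟨fun a ha => ⟨(h1 a ha).1, ?_⟩, h2⟩
    have : a ≠ N + 1 := fun e => h3 (e ▸ ha)
    have := h1 a ha
    omega
  · rintro ⟨h1, h2⟩
    exact ⟨⟨fun a ha => ⟨(h1 a ha).1, (h1 a ha).2.trans (by omega)⟩, h2⟩,
      fun hm => by have := h1 _ hm; omega⟩

/-- Removing the largest part: if the sets in `F` are those obtained from the sets in `G`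
by inserting `M` above all elements, and if this multiplies the weight by the constant `c`, then
the generating function is multiplied by `c * X ^ M`. -/
theorem genFun_eq_of_insert {F G : Finset (Finset ℕ)} {M c : ℕ}
    (hG : ∀ S ∈ G, M ∉ S) (hF : ∀ S ∈ F, M ∈ S)
    (hFG : ∀ S, M ∉ S → (insert M S ∈ F ↔ S ∈ G))
    (hw : ∀ S ∈ G, setWeight (insert M S) = setWeight S * c) :
    genFun F = X ^ M * ((c : ℤ[X]) * genFun G) := by
  unfold genFun
  rw [mul_sum, mul_sum]
  refine sum_nbij' (fun S => S.erase M) (fun S => insert M S) ?_ ?_ ?_ ?_ ?_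
  · intro S hS
    rw [← hFG _ (by simp), insert_erase (hF S hS)]
    exact hS
  · exact fun S hS => (hFG S (hG S hS)).2 hS
  · exact fun S hS => insert_erase (hF S hS)
  · exact fun S hS => erase_insert (hG S hS)
  · intro S hS
    have h1 : S.erase M ∈ G := by
      rw [← hFG _ (by simp), insert_erase (hF S hS)]
      exact hS
    have h2 := hw _ h1
    have h3 := sum_insert (f := fun i : ℕ => i) (hG _ h1)
    rw [insert_erase (hF S hS)] at h2 h3
    rw [h2, h3]
    push_cast
    ring

theorem mem_specialSets_insert {M r : ℕ} (hM : 1 ≤ M) {S : Finset ℕ} (h : M ∉ S) :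
    insert M S ∈ specialSets M r ↔ IsSpecialSet S ∧
      (∀ a ∈ S, 1 ≤ a ∧ a + 2 ≤ M ∧ (Even a ∨ Even M → a + 2 < M)) ∧
      (Even M → M ≡ 2 * oddCount S [MOD 4]) ∧ oddCount S + (if Odd M then 1 else 0) = r := by
  rw [mem_specialSets, oddCount_insert h]
  constructor
  · rintro ⟨h1, h2, h3⟩
    have h4 : ∀ a ∈ S, a < M := fun a ha =>
      lt_of_le_of_ne (h1 a (mem_insert_of_mem ha)).2 fun e => h (e ▸ ha)
    rw [isSpecialSet_insert h4] at h2
    exact ⟨h2.1, fun a ha => ⟨(h1 a (mem_insert_of_mem ha)).1, h2.2.1 a ha⟩, h2.2.2, h3⟩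
  · rintro ⟨h1, h2, h3, h4⟩
    have h5 : ∀ a ∈ S, a < M := fun a ha => by have := h2 a ha; omega
    refine ⟨?_, (isSpecialSet_insert h5).2 ⟨h1, fun a ha => (h2 a ha).2, h3⟩, h4⟩
    intro a ha
    rw [mem_insert] at ha
    rcases ha with rfl | ha
    · exact ⟨hM, le_rfl⟩
    · have := h2 a ha
      omega

/-- With `r` odd parts, an even largest part is congruent to `2 * r` modulo `4`. -/
theorem genFun_top_even_eq_zero {L r : ℕ} (h : ¬ 2 * L + 2 ≡ 2 * r [MOD 4]) :
    genFun {S ∈ specialSets (2 * L + 2) r | 2 * L + 2 ∈ S} = 0 := by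
  unfold genFun
  rw [filter_false_of_mem, sum_empty]
  intro S hS hm
  rw [← insert_erase hm, mem_specialSets_insert (by omega) (by simp)] at hS
  obtain ⟨-, -, h3, h4⟩ := hS
  rw [if_neg (by simp [parity_simps]), add_zero] at h4
  exact h (h4 ▸ h3 (by simp [parity_simps]))

theorem genFun_top_even {L r : ℕ} (h : 2 * L + 2 ≡ 2 * r [MOD 4]) :
    genFun {S ∈ specialSets (2 * L + 2) r | 2 * L + 2 ∈ S} =
      X ^ (2 * L + 2) * genFun (specialSets (2 * L) r) := by
  have hev : Even (2 * L + 2) := by simp [parity_simps]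
  have hno : ¬ Odd (2 * L + 2) := by simpa using hev
  rw [genFun_eq_of_insert (G := specialSets (2 * L) r) (c := 1), Nat.cast_one, one_mul]
  · intro S hS hm
    have := (mem_specialSets.1 hS).1 _ hm
    omega
  · exact fun S hS => (mem_filter.1 hS).2
  · intro S hS
    rw [mem_filter, mem_specialSets_insert (by omega) hS, mem_specialSets, if_neg hno, add_zero]
    constructor
    · rintro ⟨⟨h1, h2, -, h4⟩, -⟩
      refine ⟨fun a ha => ?_, h1, h4⟩
      have := (h2 a ha).2.2 (.inr hev)
      have := h2 a ha
      omega
    · rintro ⟨h1, h2, h4⟩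
      refine ⟨⟨h2, fun a ha => ?_, fun _ => h4 ▸ h, h4⟩, mem_insert_self ..⟩
      have h5 := h1 a ha
      refine ⟨h5.1, by omega, fun _ => ?_⟩
      -- The largest even number that is too close to `2 * L + 2` is in the wrong residue class.
      rcases h5.2.lt_or_eq with h6 | rfl
      · omega
      · have h7 := h2.2 _ ha (by simp)
        rw [oddBelow, Nat.ModEq] at h7
        have h8 : oddCount S = oddBelow S (2 * L) := by
          unfold oddCount oddBelow
          congr 1
          refine filter_congr fun b hb => ⟨fun ho => ⟨ho, ?_⟩, fun ho => ho.1⟩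
          have := (h1 b hb).2
          obtain ⟨k, hk⟩ := ho
          omega
        rw [← h4, h8, oddBelow, Nat.ModEq] at h
        omega
  · intro S hS
    rw [setWeight_insert, if_neg (fun h => hno h.1)]
    intro a ha
    have := (mem_specialSets.1 hS).1 _ ha
    omega

theorem genFun_top_odd_zero (L : ℕ) :
    genFun {S ∈ specialSets (2 * L + 1) 0 | 2 * L + 1 ∈ S} = 0 := by
  unfold genFun
  rw [filter_false_of_mem, sum_empty]
  intro S hS hm
  have h := (mem_specialSets.1 hS).2.2
  rw [oddCount, card_eq_zero, filter_eq_empty_iff] at h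
  exact h hm (by simp [parity_simps])

/-- Removing an odd largest part `M = 2 * L + 3`: either `M - 2` is a part, or a new chain starts
at `M`. -/
theorem genFun_top_odd_succ (L r : ℕ) :
    genFun {S ∈ specialSets (2 * L + 3) (r + 1) | 2 * L + 3 ∈ S} =
      X ^ (2 * L + 3) * (genFun {S ∈ specialSets (2 * L + 1) r | 2 * L + 1 ∈ S} +
        (if 1 ≤ L ∧ (L + 1) % 2 = r % 2 then 2 else 1) * genFun (specialSets (2 * L) r)) := by
  have hod : Odd (2 * L + 3) := by simp [parity_simps]
  have hne : ¬ Even (2 * L + 3) := by simpa using hod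
  set F := {S ∈ specialSets (2 * L + 3) (r + 1) | 2 * L + 3 ∈ S} with hF
  have hins : ∀ S, 2 * L + 3 ∉ S → (insert (2 * L + 3) S ∈ F ↔ S ∈ specialSets (2 * L + 1) r) := by
    intro S hS
    rw [hF, mem_filter, mem_specialSets_insert (by omega) hS, mem_specialSets, if_pos hod]
    constructor
    · rintro ⟨⟨h1, h2, -, h4⟩, -⟩
      exact ⟨fun a ha => by have := h2 a ha; omega, h1, by omega⟩
    · rintro ⟨h1, h2, h4⟩
      refine ⟨⟨h2, fun a ha => ?_, fun h => absurd h hne, by omega⟩, mem_insert_self ..⟩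
      have := h1 a ha
      refine ⟨by omega, by omega, ?_⟩
      rintro (⟨k, hk⟩ | h)
      · omega
      · exact absurd h hne
  have hlt : ∀ S ∈ specialSets (2 * L + 1) r, ∀ a ∈ S, a < 2 * L + 3 := fun S hS a ha => by
    have := (mem_specialSets.1 hS).1 a ha
    omega
  have hsub : ∀ S ∈ specialSets (2 * L) r, S ∈ specialSets (2 * L + 1) r ∧ 2 * L + 1 ∉ S := by
    intro S hS
    rw [mem_specialSets] at hS ⊢
    exact ⟨⟨fun a ha => by have := hS.1 a ha; omega, hS.2⟩,
      fun hm => by have := hS.1 _ hm; omega⟩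
  have hsub' : ∀ S, S ∈ specialSets (2 * L + 1) r → 2 * L + 1 ∉ S → S ∈ specialSets (2 * L) r := by
    intro S hS hn
    rw [mem_specialSets] at hS ⊢
    refine ⟨fun a ha => ?_, hS.2⟩
    have h1 := hS.1 a ha
    have h2 : a ≠ 2 * L + 1 := fun e => hn (e ▸ ha)
    omega
  rw [genFun_eq_filter_add_filter_not F (2 * L + 1 ∈ ·),
    genFun_eq_of_insert (F := {S ∈ F | 2 * L + 1 ∈ S}) (M := 2 * L + 3) (c := 1)
      (G := {S ∈ specialSets (2 * L + 1) r | 2 * L + 1 ∈ S}),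
    genFun_eq_of_insert (F := {S ∈ F | 2 * L + 1 ∉ S}) (M := 2 * L + 3)
      (c := if 1 ≤ L ∧ (L + 1) % 2 = r % 2 then 2 else 1) (G := specialSets (2 * L) r)]
  · push_cast
    ring
  · exact fun S hS hm => (hlt S (hsub S hS).1 _ hm).false
  · exact fun S hS => (mem_filter.1 (mem_filter.1 hS).1).2
  · intro S hS
    rw [mem_filter, hins S hS, mem_insert]
    exact ⟨fun h => hsub' S h.1 fun hm => h.2 (.inr hm), fun h => ⟨(hsub S h).1, by
      rintro (h' | h')
      · omega
      · exact (hsub S h).2 h'⟩⟩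
  · intro S hS
    rw [setWeight_insert (hlt S (hsub S hS).1)]
    have h1 : oddCount S = r := (mem_specialSets.1 hS).2.2
    have h2 : 2 * L + 3 - 2 ∉ S := (hsub S hS).2
    congr 1
    rw [h1]
    exact if_congr ⟨fun ⟨_, _, h3, h4⟩ => ⟨by omega, by unfold Nat.ModEq at h4; omega⟩,
      fun ⟨h3, h4⟩ => ⟨hod, h2, by omega, by unfold Nat.ModEq; omega⟩⟩ rfl rfl
  · exact fun S hS hm => (hlt S (mem_filter.1 hS).1 _ hm).false
  · exact fun S hS => (mem_filter.1 (mem_filter.1 hS).1).2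
  · intro S hS
    rw [mem_filter, hins S hS, mem_filter, mem_insert, or_iff_right (by omega)]
  · intro S hS
    rw [setWeight_insert (hlt S (mem_filter.1 hS).1), if_neg]
    exact fun h => h.2.1 (mem_filter.1 hS).2

/-! ### The closed form of the generating functions -/

/-- The generating function of the sets of `r` elements among the first `L` odd numbers. -/
noncomputable def oddGen : ℕ → ℕ → ℤ[X]
  | _, 0 => 1
  | 0, _ + 1 => 0
  | L + 1, r + 1 => oddGen L (r + 1) + X ^ (2 * L + 1) * oddGen L r

/-- The generating function of the sets of positive multiples of `4` that are at most `2 * m`. -/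
noncomputable def fourGen (m : ℕ) : ℤ[X] := ∏ j ∈ range (m / 2), (1 + X ^ (4 * (j + 1)))

@[simp] theorem oddGen_zero_right (L : ℕ) : oddGen L 0 = 1 := by cases L <;> rfl

@[simp] theorem oddGen_zero_succ (r : ℕ) : oddGen 0 (r + 1) = 0 := rfl

theorem oddGen_succ_succ (L r : ℕ) :
    oddGen (L + 1) (r + 1) = oddGen L (r + 1) + X ^ (2 * L + 1) * oddGen L r := rfl

theorem oddGen_eq_zero {L r : ℕ} (h : L < r) : oddGen L r = 0 := by
  induction L generalizing r with
  | zero => obtain ⟨r, rfl⟩ := Nat.exists_eq_succ_of_ne_zero h.ne'; rfl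
  | succ L ih =>
    obtain ⟨r, rfl⟩ := Nat.exists_eq_succ_of_ne_zero (by omega : r ≠ 0)
    rw [oddGen_succ_succ, ih (by omega), ih (by omega), mul_zero, add_zero]

/-- The second `q`-Pascal rule: it splits the sets of odd numbers by whether they contain `1`,
and lowers the other elements by `2`. -/
theorem oddGen_succ_succ' (L r : ℕ) :
    oddGen (L + 1) (r + 1) = X ^ (2 * r + 2) * oddGen L (r + 1) + X ^ (2 * r + 1) * oddGen L r := by
  induction L generalizing r with
  | zero => cases r <;> simp [oddGen_succ_succ]
  | succ L ih =>
    rw [oddGen_succ_succ (L + 1) r]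
    have h := oddGen_succ_succ L r
    cases r with
    | zero =>
      have h0 := oddGen_zero_right L
      have h1 := oddGen_zero_right (L + 1)
      linear_combination ih 0 - X ^ 2 * h + (X - X ^ (2 * L + 3)) * (h0 - h1)
    | succ r =>
      linear_combination ih (r + 1) - X ^ (2 * r + 4) * h -
        X ^ (2 * r + 3) * oddGen_succ_succ L r + X ^ (2 * L + 3) * ih r

theorem fourGen_succ_of_even {m : ℕ} (h : m % 2 = 0) : fourGen (m + 1) = fourGen m := by
  unfold fourGen
  rw [show (m + 1) / 2 = m / 2 by omega]

theorem fourGen_succ_of_odd {m : ℕ} (h : m % 2 = 1) :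
    fourGen (m + 1) = fourGen m * (1 + X ^ (2 * m + 2)) := by
  unfold fourGen
  rw [show (m + 1) / 2 = m / 2 + 1 by omega, prod_range_succ,
    show 4 * (m / 2 + 1) = 2 * m + 2 by omega]

/-- The factor of the generating function of the special sets with largest part `2 * L + 1` that
comes from the even parts and the weights, for `m` the excess of `L` over the number of odd parts
below. -/
noncomputable def topFactor (m : ℕ) : ℤ[X] :=
  if m = 0 then 1 else if m % 2 = 1 then fourGen m else 2 * fourGen (m - 1)

theorem genFun_specialSets_zero (r : ℕ) : genFun (specialSets 0 r) = oddGen 0 r := by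
  have h : specialSets 0 r = if r = 0 then {∅} else ∅ := by
    ext S
    rw [mem_specialSets]
    constructor
    · rintro ⟨h1, -, h3⟩
      have : S = ∅ := eq_empty_of_forall_notMem fun a ha => by have := h1 a ha; omega
      subst this
      rw [← h3]
      simp [oddCount]
    · intro h
      split_ifs at h with hr
      · rw [mem_singleton] at h
        subst h hr
        simp [oddCount, IsSpecialSet]
      · simp at h
  rw [h]
  cases r <;> simp [genFun, setWeight]

theorem genFun_top_one (r : ℕ) :
    genFun {S ∈ specialSets 1 (r + 1) | 1 ∈ S} = X * genFun (specialSets 0 r) := by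
  have hG : ∀ S ∈ specialSets 0 r, S = ∅ := fun S hS =>
    eq_empty_of_forall_notMem fun a ha => by have := (mem_specialSets.1 hS).1 a ha; omega
  rw [genFun_eq_of_insert (M := 1) (c := 1) (G := specialSets 0 r), pow_one, Nat.cast_one, one_mul]
  · intro S hS
    rw [hG S hS]
    simp
  · exact fun S hS => (mem_filter.1 hS).2
  · intro S hS
    rw [mem_filter, mem_specialSets_insert le_rfl hS, mem_specialSets, if_pos odd_one]
    constructor
    · rintro ⟨⟨h1, h2, -, h4⟩, -⟩
      exact ⟨fun a ha => by have := h2 a ha; omega, h1, by omega⟩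
    · rintro ⟨h1, h2, h4⟩
      exact ⟨⟨h2, fun a ha => by have := h1 a ha; omega, by simp, by omega⟩, mem_insert_self ..⟩
  · intro S hS
    rw [hG S hS]
    simp [setWeight, partWeight]

/-- The special sets with largest part `2 * L + 3`, from the two generating functions for `L`. -/
theorem genFun_top_step {L : ℕ}
    (h1 : ∀ r, genFun (specialSets (2 * L) r) = oddGen L r * fourGen (L - r))
    (h2 : ∀ r, genFun {S ∈ specialSets (2 * L + 1) (r + 1) | 2 * L + 1 ∈ S} =
      X ^ (2 * L + 1) * (oddGen L r * topFactor (L - r))) (r : ℕ) :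
    genFun {S ∈ specialSets (2 * L + 3) (r + 1) | 2 * L + 3 ∈ S} =
      X ^ (2 * L + 3) * (oddGen (L + 1) r * topFactor (L + 1 - r)) := by
  rw [genFun_top_odd_succ, h1]
  congr 1
  cases r with
  | zero =>
    simp only [genFun_top_odd_zero, oddGen_zero_right, Nat.sub_zero, one_mul, zero_add]
    rw [topFactor, if_neg (Nat.succ_ne_zero L), Nat.add_sub_cancel]
    rcases Nat.mod_two_eq_zero_or_one L with hL | hL
    · rw [if_neg (by omega), if_pos (by omega), fourGen_succ_of_even hL, one_mul]
    · rw [if_pos (by omega), if_neg (by omega)]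
  | succ r =>
    rw [h2, oddGen_succ_succ, show L + 1 - (r + 1) = L - r by omega]
    rcases lt_trichotomy L r with h | rfl | h
    · simp [oddGen_eq_zero h, oddGen_eq_zero (h.trans (Nat.lt_succ_self r))]
    · simp [oddGen_eq_zero (Nat.lt_succ_self L), topFactor]
    · obtain ⟨k, rfl⟩ := Nat.exists_eq_add_of_lt h
      rw [show r + k + 1 - r = k + 1 by omega, show r + k + 1 - (r + 1) = k by omega, topFactor,
        if_neg (by omega), Nat.add_sub_cancel]
      rcases Nat.mod_two_eq_zero_or_one k with hk | hk
      · rw [if_pos (by omega), if_neg (by omega), fourGen_succ_of_even hk]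
        ring
      · rw [if_neg (by omega), if_pos (by omega)]
        ring

/-- The special sets of parts up to `2 * L + 2`, from the two generating functions for `L`. -/
theorem genFun_step {L : ℕ}
    (h1 : ∀ r, genFun (specialSets (2 * L) r) = oddGen L r * fourGen (L - r))
    (h2 : ∀ r, genFun {S ∈ specialSets (2 * L + 1) (r + 1) | 2 * L + 1 ∈ S} =
      X ^ (2 * L + 1) * (oddGen L r * topFactor (L - r))) (r : ℕ) :
    genFun (specialSets (2 * L + 2) r) = oddGen (L + 1) r * fourGen (L + 1 - r) := by
  rw [genFun_specialSets_succ, genFun_specialSets_succ, h1]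
  have h3 : genFun {S ∈ specialSets (2 * L + 1 + 1) r | 2 * L + 1 + 1 ∈ S} =
      if (L + 1) % 2 = r % 2 then X ^ (2 * L + 2) * (oddGen L r * fourGen (L - r)) else 0 := by
    split_ifs with h
    · rw [← h1, ← genFun_top_even (by unfold Nat.ModEq; omega)]
    · exact genFun_top_even_eq_zero (by unfold Nat.ModEq; omega)
  rw [h3]
  cases r with
  | zero =>
    rw [genFun_top_odd_zero]
    simp only [oddGen_zero_right, Nat.sub_zero, one_mul, add_zero]
    split_ifs
    · rw [fourGen_succ_of_odd (by omega)]
      ring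
    · rw [fourGen_succ_of_even (by omega)]
      ring
  | succ r =>
    rw [h2, show L + 1 - (r + 1) = L - r by omega]
    rcases lt_trichotomy L r with h | rfl | h
    · simp [oddGen_succ_succ, oddGen_eq_zero h, oddGen_eq_zero (h.trans (Nat.lt_succ_self r))]
    · simp [oddGen_succ_succ, oddGen_eq_zero (Nat.lt_succ_self L), topFactor, fourGen]
    · obtain ⟨k, rfl⟩ := Nat.exists_eq_add_of_lt h
      rw [show r + k + 1 - r = k + 1 by omega, show r + k + 1 - (r + 1) = k by omega, topFactor,
        if_neg (by omega), Nat.add_sub_cancel]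
      rcases Nat.mod_two_eq_zero_or_one k with hk | hk
      · rw [if_pos (by omega), if_neg (by omega), fourGen_succ_of_even hk,
          oddGen_succ_succ (r + k + 1) r]
        ring
      · -- Expanding `1 + X ^ (2 * k + 2)`, the two terms need different `q`-Pascal rules.
        rw [if_neg (by omega), if_pos (by omega), fourGen_succ_of_odd hk]
        linear_combination (-fourGen k) * oddGen_succ_succ (r + k + 1) r -
          fourGen k * X ^ (2 * k + 2) * oddGen_succ_succ' (r + k + 1) r

/-- The special sets of parts up to `2 * L` with `r` odd parts have the same generating function
as the pairs of a set of `r` among the first `L` odd numbers and a set of multiples of `4` up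
to `2 * (L - r)`. -/
theorem genFun_specialSets (L r : ℕ) :
    genFun (specialSets (2 * L) r) = oddGen L r * fourGen (L - r) := by
  suffices h : ∀ L, (∀ r, genFun (specialSets (2 * L) r) = oddGen L r * fourGen (L - r)) ∧
      ∀ r, genFun {S ∈ specialSets (2 * L + 1) (r + 1) | 2 * L + 1 ∈ S} =
        X ^ (2 * L + 1) * (oddGen L r * topFactor (L - r)) from (h L).1 r
  intro L
  induction L with
  | zero =>
    refine ⟨fun r => ?_, fun r => ?_⟩
    · simp [genFun_specialSets_zero, fourGen]
    · simp [genFun_top_one, genFun_specialSets_zero, topFactor]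
  | succ L ih => exact ⟨genFun_step ih.1 ih.2, genFun_top_step ih.1 ih.2⟩

/-! ### Chains and their least parts -/

/-- The string `{l, l + 2, …, l + 2 (k - 1)}`. -/
def stringFrom (l k : ℕ) : Finset ℕ := (range k).image (fun i => l + 2 * i)

theorem mem_stringFrom {l k x : ℕ} : x ∈ stringFrom l k ↔ ∃ i < k, l + 2 * i = x := by
  simp [stringFrom]

theorem self_mem_stringFrom {l k : ℕ} (h : 0 < k) : l ∈ stringFrom l k :=
  mem_stringFrom.2 ⟨0, h, rfl⟩

theorem card_stringFrom (l k : ℕ) : #(stringFrom l k) = k := by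
  rw [stringFrom, card_image_of_injective _ (fun a b h => by simpa using h), card_range]

theorem isString_iff {c : Finset ℕ} : IsString c ↔ ∃ l k, 0 < k ∧ c = stringFrom l k := by
  constructor
  · rintro ⟨l, hl, hc⟩
    exact ⟨l, #c, card_pos.2 ⟨l, hl⟩, hc⟩
  · rintro ⟨l, k, hk, rfl⟩
    exact ⟨l, self_mem_stringFrom hk, by rw [card_stringFrom]; rfl⟩

/-- The elements `l` of `S` with `l - 2` not in `S`, which are the least elements of the chains. -/
def chainStarts (S : Finset ℕ) : Finset ℕ := {l ∈ S | ∀ a ∈ S, a + 2 ≠ l}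

theorem exists_add_two_mul_notMem (S : Finset ℕ) (l : ℕ) : ∃ k, l + 2 * k ∉ S :=
  ⟨S.sup id + 1, fun h => by have := le_sup (f := id) h; simp only [id] at this; omega⟩

/-- The largest `k` for which `stringFrom l k` lies in `S`. -/
def runLength (S : Finset ℕ) (l : ℕ) : ℕ := Nat.find (exists_add_two_mul_notMem S l)

theorem stringFrom_subset_iff {S : Finset ℕ} {l k : ℕ} :
    stringFrom l k ⊆ S ↔ k ≤ runLength S l := by
  constructor
  · intro h
    by_contra! hk
    exact Nat.find_spec (exists_add_two_mul_notMem S l) (h (mem_stringFrom.2 ⟨_, hk, rfl⟩))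
  · intro h x hx
    obtain ⟨i, hi, rfl⟩ := mem_stringFrom.1 hx
    simpa using Nat.find_min (exists_add_two_mul_notMem S l) (hi.trans_le h)

theorem stringFrom_subset_stringFrom {l k m : ℕ} (h : k ≤ m) :
    stringFrom l k ⊆ stringFrom l m := by
  intro x hx
  obtain ⟨i, hi, rfl⟩ := mem_stringFrom.1 hx
  exact mem_stringFrom.2 ⟨i, by omega, rfl⟩

theorem runLength_pos {S : Finset ℕ} {l : ℕ} (h : l ∈ S) : 0 < runLength S l := by
  refine stringFrom_subset_iff.1 fun x hx => ?_
  obtain ⟨i, hi, rfl⟩ := mem_stringFrom.1 hx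
  obtain rfl : i = 0 := by omega
  simpa using h

theorem mem_strings {n : ℕ} {π : n.Partition} {c : Finset ℕ} :
    c ∈ strings π ↔ c ⊆ π.parts.toFinset ∧ ∃ l k, 0 < k ∧ c = stringFrom l k := by
  rw [strings, mem_filter, mem_powerset, isString_iff]

theorem chains_eq_image {n : ℕ} (π : n.Partition) :
    chains π = (chainStarts π.parts.toFinset).image
      (fun l => stringFrom l (runLength π.parts.toFinset l)) := by
  set S := π.parts.toFinset with hS
  ext c
  simp only [chains, mem_filter, mem_image]
  constructor
  · rintro ⟨hc, hmax⟩
    obtain ⟨hcS, l, k, hk, rfl⟩ := mem_strings.1 hc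
    have hl : l ∈ stringFrom l k := self_mem_stringFrom hk
    refine ⟨l, mem_filter.2 ⟨hcS hl, ?_⟩, ?_⟩
    · rintro a ha rfl
      have hsub : stringFrom (a + 2) k ⊆ stringFrom a (k + 1) := by
        intro x hx
        obtain ⟨i, hi, rfl⟩ := mem_stringFrom.1 hx
        exact mem_stringFrom.2 ⟨i + 1, by omega, by ring⟩
      have h := hmax (stringFrom a (k + 1)) (mem_strings.2 ⟨?_, a, k + 1, by omega, rfl⟩) hsub
      · have := congrArg card h
        simp [card_stringFrom] at this
      · intro x hx
        obtain ⟨i, hi, rfl⟩ := mem_stringFrom.1 hx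
        cases i with
        | zero => exact ha
        | succ i => exact hcS (mem_stringFrom.2 ⟨i, by omega, by ring⟩)
    · have hk' := stringFrom_subset_iff.1 hcS
      exact hmax _ (mem_strings.2 ⟨stringFrom_subset_iff.2 le_rfl, l, _, hk.trans_le hk', rfl⟩)
        (stringFrom_subset_stringFrom hk')
  · rintro ⟨l, hl, rfl⟩
    obtain ⟨hlS, hstart⟩ := mem_filter.1 hl
    refine ⟨mem_strings.2 ⟨stringFrom_subset_iff.2 le_rfl, l, _, runLength_pos hlS, rfl⟩, ?_⟩
    intro d hd hsub
    obtain ⟨hdS, a, k, hk, rfl⟩ := mem_strings.1 hd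
    obtain ⟨i, hi, rfl⟩ := mem_stringFrom.1 (hsub (self_mem_stringFrom (runLength_pos hlS)))
    cases i with
    | zero =>
      exact subset_antisymm (stringFrom_subset_stringFrom (stringFrom_subset_iff.1 hdS)) hsub
    | succ i =>
      exact absurd (by ring) (hstart (a + 2 * i) (hdS (mem_stringFrom.2 ⟨i, by omega, rfl⟩)))

theorem t_eq_oddBelow {n : ℕ} {π : n.Partition} (h : π.parts.Nodup) (b : ℕ) :
    t π b = oddBelow π.parts.toFinset b := by
  unfold t oddBelow
  rw [card_def, filter_val, Multiset.toFinset_val, h.dedup]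

theorem chainWeight_stringFrom {n : ℕ} {π : n.Partition} (h : π.parts.Nodup) {l : ℕ}
    (hl : l ∈ chainStarts π.parts.toFinset) :
    chainWeight π (stringFrom l (runLength π.parts.toFinset l)) =
      partWeight π.parts.toFinset l := by
  obtain ⟨hlS, hstart⟩ := mem_filter.1 hl
  have hmem := self_mem_stringFrom (l := l) (runLength_pos hlS)
  have hle : ∀ x ∈ stringFrom l (runLength π.parts.toFinset l), l ≤ x := by
    intro x hx
    obtain ⟨i, -, rfl⟩ := mem_stringFrom.1 hx
    omega
  unfold chainWeight partWeight
  refine if_congr ⟨?_, ?_⟩ rfl rfl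
  · rintro ⟨hodd, m, hm, hmin, h5, hmod⟩
    obtain rfl : m = l := le_antisymm (hmin l hmem) (hle m hm)
    rw [t_eq_oddBelow h] at hmod
    exact ⟨hodd _ hmem, fun hs => hstart _ hs (by omega), h5, hmod⟩
  · rintro ⟨hodd, -, h5, hmod⟩
    refine ⟨fun x hx => ?_, l, hmem, hle, h5, by rwa [t_eq_oddBelow h]⟩
    obtain ⟨i, -, rfl⟩ := mem_stringFrom.1 hx
    exact hodd.add_even (even_two_mul i)

theorem weight_eq_setWeight {n : ℕ} {π : n.Partition} (h : π.parts.Nodup) :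
    weight π = setWeight π.parts.toFinset := by
  unfold weight setWeight
  rw [chains_eq_image, prod_image, prod_congr rfl fun l hl => chainWeight_stringFrom h hl]
  · refine prod_subset (filter_subset _ _) fun l hl hn => if_neg ?_
    rintro ⟨-, h2, -⟩
    refine hn (mem_filter.2 ⟨hl, ?_⟩)
    rintro a ha rfl
    exact h2 ha
  · intro l hl m hm hlm
    have hl' := runLength_pos (mem_filter.1 hl).1
    have hm' := runLength_pos (mem_filter.1 hm).1
    dsimp only at hlm
    have h1 : l ∈ stringFrom m (runLength π.parts.toFinset m) :=
      hlm ▸ self_mem_stringFrom hl'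
    have h2 : m ∈ stringFrom l (runLength π.parts.toFinset l) :=
      hlm ▸ self_mem_stringFrom hm'
    obtain ⟨i, -, hi⟩ := mem_stringFrom.1 h1
    obtain ⟨j, -, hj⟩ := mem_stringFrom.1 h2
    omega

/-! ### Partitions as coefficients -/

theorem sum_distincts {n N : ℕ} (h : n ≤ N) (f : Finset ℕ → ℕ) :
    ∑ π ∈ Nat.Partition.distincts n, f π.parts.toFinset =
      ∑ S ∈ (Icc 1 N).powerset with ∑ i ∈ S, i = n, f S := by
  have hnd : ∀ π ∈ Nat.Partition.distincts n, π.parts.Nodup := fun π hπ => by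
    simpa [Nat.Partition.distincts] using hπ
  refine sum_nbij (fun π => π.parts.toFinset) ?_ ?_ ?_ fun _ _ => rfl
  · intro π hπ
    have hsum : ∑ i ∈ π.parts.toFinset, i = n := by
      rw [sum_eq_multiset_sum, Multiset.toFinset_val, (hnd π hπ).dedup, Multiset.map_id',
        π.parts_sum]
    rw [mem_filter, mem_powerset]
    refine ⟨fun a ha => mem_Icc.2 ⟨π.parts_pos (Multiset.mem_toFinset.1 ha), ?_⟩, hsum⟩
    have := single_le_sum (f := fun i : ℕ => i) (fun _ _ => Nat.zero_le _) ha
    omega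
  · intro π hπ ρ hρ hπρ
    have := congrArg val hπρ
    simp only [Multiset.toFinset_val] at this
    rw [(hnd π hπ).dedup, (hnd ρ hρ).dedup] at this
    exact Nat.Partition.ext this
  · intro S hS
    rw [mem_coe, mem_filter, mem_powerset] at hS
    refine ⟨⟨S.val, fun {i} hi => (mem_Icc.1 (hS.1 hi)).1, ?_⟩, ?_, ?_⟩
    · rw [← hS.2, sum_eq_multiset_sum, Multiset.map_id']
    · simpa [Nat.Partition.distincts] using S.nodup
    · simp

theorem isSpecial_iff {n : ℕ} (π : n.Partition) :
    IsSpecial π ↔ π.parts.Nodup ∧ IsSpecialSet π.parts.toFinset := by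
  unfold IsSpecial IsGollnitzGordon IsSpecialSet
  simp only [Multiset.mem_toFinset]
  constructor
  · rintro ⟨⟨h1, h2⟩, h3⟩
    exact ⟨h1, h2, fun b hb hev => t_eq_oddBelow h1 b ▸ h3 b hb hev⟩
  · rintro ⟨h1, h2, h3⟩
    exact ⟨⟨h1, h2⟩, fun b hb hev => t_eq_oddBelow h1 b ▸ h3 b hb hev⟩

theorem sum_special_weight {n N : ℕ} (h : n ≤ N) :
    ∑ π ∈ special n, weight π =
      ∑ S ∈ (Icc 1 N).powerset with ∑ i ∈ S, i = n, if IsSpecialSet S then setWeight S else 0 := by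
  rw [← sum_distincts h, ← sum_filter]
  refine sum_congr ?_ fun π hπ => weight_eq_setWeight ?_
  · ext π
    simp [special, Nat.Partition.distincts, isSpecial_iff]
  · simp only [Nat.Partition.distincts, mem_filter] at hπ
    exact hπ.1.2

theorem coeff_sum_genFun {n N : ℕ} (h : n ≤ N) :
    (∑ r ∈ range (N + 1), genFun (specialSets N r)).coeff n =
      ((∑ π ∈ special n, weight π : ℕ) : ℤ) := by
  have hcard : ∀ S ∈ {S ∈ (Icc 1 N).powerset | IsSpecialSet S}, oddCount S ∈ range (N + 1) := by
    intro S hS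
    have h1 := card_le_card (mem_powerset.1 (mem_filter.1 hS).1)
    rw [Nat.card_Icc] at h1
    have h2 : oddCount S ≤ #S := card_filter_le _ _
    rw [mem_range]
    omega
  have hsum := sum_fiberwise_of_maps_to hcard
    (fun S => (setWeight S : ℤ[X]) * X ^ (∑ i ∈ S, i))
  simp only [filter_filter] at hsum
  rw [sum_special_weight h]
  unfold genFun specialSets
  rw [hsum, finsetSum_coeff, sum_filter, sum_filter, Nat.cast_sum]
  refine sum_congr rfl fun S _ => ?_
  rw [← C_eq_natCast, coeff_C_mul, coeff_X_pow]
  simp only [eq_comm (a := n)]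
  split_ifs <;> simp

theorem coeff_prod_one_add_X_pow {n N : ℕ} (h : n ≤ N) :
    (∏ i ∈ Icc 1 N with ¬ i ≡ 2 [MOD 4], (1 + X ^ i : ℤ[X])).coeff n = (Q 2 n : ℤ) := by
  have hQ : Q 2 n = ∑ S ∈ (Icc 1 N).powerset with ∑ i ∈ S, i = n,
      if ∀ a ∈ S, ¬ a ≡ 2 [MOD 4] then 1 else 0 := by
    rw [← sum_distincts h, Q, card_filter]
    simp only [Multiset.mem_toFinset]
  have hpow : {i ∈ Icc 1 N | ¬ i ≡ 2 [MOD 4]}.powerset =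
      {S ∈ (Icc 1 N).powerset | ∀ a ∈ S, ¬ a ≡ 2 [MOD 4]} := by
    ext S
    simp only [mem_powerset, mem_filter, subset_iff]
    exact ⟨fun h => ⟨fun a ha => (h ha).1, fun a ha => (h ha).2⟩,
      fun h a ha => ⟨h.1 ha, h.2 a ha⟩⟩
  rw [prod_one_add, hpow, finsetSum_coeff, hQ, sum_filter, sum_filter, Nat.cast_sum]
  refine sum_congr rfl fun S _ => ?_
  rw [prod_pow_eq_pow_sum, coeff_X_pow]
  simp only [eq_comm (a := n)]
  split_ifs <;> simp

/-! ### Comparison of the generating functions -/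

theorem sum_oddGen {L R : ℕ} (h : L ≤ R) :
    ∑ r ∈ range (R + 1), oddGen L r = ∏ i ∈ range L, (1 + X ^ (2 * i + 1)) := by
  induction L generalizing R with
  | zero => simp [sum_range_succ']
  | succ L ih =>
    obtain ⟨R, rfl⟩ := Nat.exists_eq_add_of_le' (by omega : 1 ≤ R)
    have h1 := ih (R := R + 1) (by omega)
    rw [sum_range_succ', oddGen_zero_right] at h1
    rw [prod_range_succ, sum_range_succ', oddGen_zero_right]
    simp only [oddGen_succ_succ, sum_add_distrib, ← mul_sum]
    rw [ih (R := R) (by omega)]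
    linear_combination h1

theorem X_pow_dvd_oddGen (L r : ℕ) : X ^ r ∣ oddGen L r := by
  induction L generalizing r with
  | zero => cases r <;> simp
  | succ L ih =>
    cases r with
    | zero => simp
    | succ r =>
      rw [oddGen_succ_succ, pow_succ']
      refine dvd_add (pow_succ' (X : ℤ[X]) r ▸ ih (r + 1)) (mul_dvd_mul ?_ (ih r))
      exact dvd_pow_self _ (by omega)

theorem X_pow_dvd_fourGen_sub {n m : ℕ} (h : n ≤ m) :
    (X : ℤ[X]) ^ (n + 1) ∣ fourGen m - fourGen n := by
  induction m, h using Nat.le_induction with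
  | base => simp
  | succ m hm ih =>
    rcases Nat.mod_two_eq_zero_or_one m with h | h
    · rwa [fourGen_succ_of_even h]
    · rw [fourGen_succ_of_odd h, mul_add, mul_one, add_sub_right_comm]
      exact dvd_add ih (dvd_mul_of_dvd_right (pow_dvd_pow _ (by omega)) _)

theorem prod_odd_mul_fourGen (n : ℕ) :
    (∏ i ∈ range (2 * n), (1 + X ^ (2 * i + 1))) * fourGen (2 * n) =
      ∏ i ∈ Icc 1 (4 * n) with ¬ i ≡ 2 [MOD 4], (1 + X ^ i : ℤ[X]) := by
  rw [prod_filter]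
  induction n with
  | zero => simp [fourGen]
  | succ n ih =>
    rw [mul_add, mul_add, mul_one, mul_one, prod_range_succ, prod_range_succ,
      fourGen_succ_of_odd (by omega), fourGen_succ_of_even (by omega),
      prod_Icc_succ_top (by omega), prod_Icc_succ_top (by omega), prod_Icc_succ_top (by omega),
      prod_Icc_succ_top (by omega), ← ih, if_pos (by unfold Nat.ModEq; omega),
      if_neg (by unfold Nat.ModEq; omega), if_pos (by unfold Nat.ModEq; omega),
      if_pos (by unfold Nat.ModEq; omega)]
    ring

/-- Up to degree `n`, the bound `2 * (L - r)` on the multiples of `4` does not matter for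
`L = 2 * n`: either `r ≤ n` and the bound is at least `2 * n`, or the `r` odd parts already have a
sum above `n`. -/
theorem X_pow_dvd_oddGen_mul_sub (n r : ℕ) :
    (X : ℤ[X]) ^ (n + 1) ∣
      oddGen (2 * n) r * fourGen (2 * n - r) - oddGen (2 * n) r * fourGen (2 * n) := by
  rw [← mul_sub]
  rcases le_or_gt r n with h | h
  · refine dvd_mul_of_dvd_right ?_ _
    rw [← sub_sub_sub_cancel_right _ _ (fourGen n)]
    exact dvd_sub (X_pow_dvd_fourGen_sub (by omega)) (X_pow_dvd_fourGen_sub (by omega))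
  · exact dvd_mul_of_dvd_left ((pow_dvd_pow _ h).trans (X_pow_dvd_oddGen _ _)) _

end GollnitzGordon

theorem theorem3 (n : ℕ) :
    GollnitzGordon.Q 2 n = ∑ π ∈ GollnitzGordon.special n, GollnitzGordon.weight π := by
  have hdvd := Finset.dvd_sum (s := Finset.range (2 * (2 * n) + 1)) fun r _ =>
    GollnitzGordon.X_pow_dvd_oddGen_mul_sub n r
  rw [Finset.sum_sub_distrib, ← Finset.sum_mul, GollnitzGordon.sum_oddGen (by omega),
    GollnitzGordon.prod_odd_mul_fourGen] at hdvd
  have hcoeff := Polynomial.X_pow_dvd_iff.1 hdvd n (Nat.lt_succ_self n)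
  simp only [← GollnitzGordon.genFun_specialSets] at hcoeff
  rw [Polynomial.coeff_sub, GollnitzGordon.coeff_sum_genFun (by omega),
    GollnitzGordon.coeff_prod_one_add_X_pow (by omega), sub_eq_zero] at hcoeff
  exact_mod_cast hcoeff.symm
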